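/- **Proposition.** For a finitely supported function $f:\mathbb{Z}\to[0,\infty)$ with support $\{x: f(x)>0\}=\{x_0<x_1<\cdots<x_n\}$, let $f^{\#}:\mathbb{Z}\to[0,\infty)$ be defined by $f^{\#}(r)=f(x_r)$ for $r\in\{0,\dots,n\}$ and $f^{\#}(k)=0$ for all other integers $k$. Call $f$ *$\#$-log-concave* if $f^{\#}(i)^2\ge f^{\#}(i-1)f^{\#}(i+1)$ for all $i\in\mathbb{Z}$. An integer-valued random variable $X$ with finitely supported probability mass function $f$ is called $\#$-log-concave if $f$ is, and $X^{\#}$ denotes a random variable with probability mass function $f^{\#}$. For an integer-valued random variable $X$ with finitely supported probability mass function $f$, the Rényi entropy of order $\alpha\in[0,\infty]$ is $$H_\alpha(X)=\frac{1}{1-\alpha}\log\Big(\sum_{i\in\mathbb{Z}}f(i)^\alpha\Big)\quad(\alpha\in(0,1)\cup(1,\infty)),$$ $$H_0(X)=\log|\{i\in\mathbb{Z}: f(i)>0\}|,\qquad H_1(X)=-\sum_{i\in\mathbb{Z}}f(i)\log f(i),\qquad H_\infty(X)=-\log\sup_{i\in\mathbb{Z}}f(i),$$ with the convention $0\log 0=0$.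 Let $X_1,\dots,X_N$ be independent integer-valued random variables with finite support, each of them $\#$-log-concave, and let $X_1^{\#},\dots,X_N^{\#}$ be independent random variables, where $X_i^{\#}$ has probability mass function $f_i^{\#}$ and $f_i$ is the probability mass function of $X_i$. Then, for every $\alpha\in[0,\infty]$, $$H_\alpha(X_1+\cdots+X_N)\ \ge\ H_\alpha(X_1^{\#}+\cdots+X_N^{\#}).$$ -/

import Mathlib

open MeasureTheory ProbabilityTheory
open scoped ENNReal

noncomputable section

/-- The probability mass function `k ↦ P(X = k)` of an integer-valued random variable. -/
def massFun {Ω : Type*} [MeasurableSpace Ω] (P : Measure Ω) (X : Ω → ℤ) : ℤ → ℝ :=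
  fun k => P.real (X ⁻¹' {k})

/-- The support `{x : f x > 0}` of a non-negative function on the integers. -/
def posSupp (f : ℤ → ℝ) : Set ℤ := {x | 0 < f x}

/-- The squeezed rearrangement `f^#` of a finitely supported non-negative function: if the support
of `f` is `{x₀ < ⋯ < xₙ}`, then `f^#` takes the value `f (x_r)` at `r` for `r = 0, …, n`,
and vanishes elsewhere. -/
def hashFun (f : ℤ → ℝ) (hf : (posSupp f).Finite) : ℤ → ℝ :=
  fun k => ∑ r : Fin hf.toFinset.card,
    if k = ((r : ℕ) : ℤ) then f (hf.toFinset.orderEmbOfFin rfl r) else 0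

/-- Log-concavity of a function on the integers. -/
def IsLogConcaveInt (f : ℤ → ℝ) : Prop :=
  ∀ i : ℤ, f (i - 1) * f (i + 1) ≤ f i ^ 2

/-- A finitely supported non-negative function `f` is `#`-log-concave if `f^#` is log-concave. -/
def IsHashLogConcave (f : ℤ → ℝ) (hf : (posSupp f).Finite) : Prop :=
  IsLogConcaveInt (hashFun f hf)

/-- The Rényi entropy of order `α ∈ [0, ∞]` of a probability mass function on the integers. It is
only used for finitely supported mass functions, for which it is a finite real number. -/
def renyiEntropyOfMass (α : ℝ≥0∞) (f : ℤ → ℝ) : ℝ :=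
  if α = 0 then Real.log ((posSupp f).ncard : ℝ)
  else if α = 1 then ∑' i : ℤ, -(f i * Real.log (f i))
  else if α = ∞ then -Real.log (⨆ i : ℤ, f i)
  else 1 / (1 - α.toReal) * Real.log (∑' i : ℤ, f i ^ α.toReal)

/-- The Rényi entropy `H_α(X)` of an integer-valued random variable. -/
def renyiEntropy {Ω : Type*} [MeasurableSpace Ω] (α : ℝ≥0∞) (P : Measure Ω) (X : Ω → ℤ) : ℝ :=
  renyiEntropyOfMass α (massFun P X)

end

/-! The law of the original sum is a random strictly increasing image of the law `w` of the squeezed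
sum (`IsMonoMixture`): some random map `T`, strictly increasing on the support of `w`, carries `w`
on average to the law `g` of the original sum. Since `T` is injective, the matrix `P(T r = a)` has
row sums 1 and column sums at most 1, so Jensen gives `∑ φ(g) ≤ ∑ φ(w)` for convex `φ` with `φ 0 =
0`. Suitable `φ` settle the finite positive orders; the orders 0 and ∞ follow from the matrix
directly.

The maps are built by adding one summand at a time. If `X` and `Y` are independent and log-concave,
the laws of `Y` given `X + Y = r` can be coupled over all `r` so that `Y` and `X = r - Y` are both
nondecreasing in `r` (`exists_monotone_coupling`). If `T` serves `X` and `t` unsqueezes `Y`, then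
`T(r - Y) + t(Y)` is strictly increasing in `r` and serves the sum. Log-concavity persists because
it is closed under convolution. -/

/-! ### Log-concave sequences and their convolutions -/

/-- Log-concavity of a sequence in its total-positivity form, which for non-negative sequences
amounts to log-concavity together with the absence of internal zeros. -/
def IsTotallyLogConcave (f : ℤ → ℝ) : Prop :=
  ∀ a b c d : ℤ, a ≤ b → b ≤ d → a + d = b + c → f a * f d ≤ f b * f c

/-- Widening a window one step at a time multiplies two instances of the inequality and cancels the
common factor. Connected support keeps that factor positive; without it `1, 0, 0, 1` is a
counterexample. -/
theorem IsTotallyLogConcave.of_isLogConcaveInt {f : ℤ → ℝ} (hf0 : ∀ x, 0 ≤ f x)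
    (hf : IsLogConcaveInt f) (hconn : ∀ x y z, x ≤ y → y ≤ z → 0 < f x → 0 < f z → 0 < f y) :
    IsTotallyLogConcave f := by
  have neighbour : ∀ (a : ℤ) (n : ℕ), f (a - 1) * f (a + n + 1) ≤ f a * f (a + n) := by
    intro a n
    induction n with
    | zero =>
      have := hf a
      simpa [sq] using this
    | succ n ih =>
      rcases (hf0 (a - 1)).eq_or_lt with h | h1
      · rw [← h, zero_mul]; exact mul_nonneg (hf0 _) (hf0 _)
      rcases (hf0 (a + (n + 1 : ℕ) + 1)).eq_or_lt with h | h2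
      · rw [← h, mul_zero]; exact mul_nonneg (hf0 _) (hf0 _)
      have p1 : 0 < f (a + n) := hconn _ _ _ (by omega) (by omega) h1 h2
      have p2 : 0 < f (a + n + 1) := hconn _ _ _ (by omega) (by omega) h1 h2
      have key := hf (a + n + 1)
      have e1 : a + (n : ℤ) + 1 - 1 = a + n := by ring
      have e2 : a + (n : ℤ) + 1 + 1 = a + (n + 1 : ℕ) + 1 := by push_cast; ring
      have e3 : a + ((n + 1 : ℕ) : ℤ) = a + n + 1 := by push_cast; ring
      rw [e1, e2] at key
      rw [e3] at key h2 ⊢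
      have h3 := mul_le_mul ih key (mul_nonneg (hf0 _) (hf0 _)) (mul_nonneg (hf0 _) (hf0 _))
      refine le_of_mul_le_mul_right (a := f (a + n) * f (a + n + 1)) ?_ (mul_pos p1 p2)
      calc _ = f (a - 1) * f (a + n + 1) * (f (a + n) * f (a + n + 1 + 1)) := by ring
        _ ≤ _ := h3
        _ = _ := by ring
  have spread : ∀ (a b : ℤ) (c : ℕ), a ≤ b → f (a - c) * f (b + c) ≤ f a * f b := by
    intro a b c hab
    induction c with
    | zero => simp
    | succ c ih =>
      refine le_trans ?_ ih
      obtain ⟨n, hn⟩ := Int.eq_ofNat_of_zero_le (show 0 ≤ b + c - (a - c) by omega)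
      have := neighbour (a - c) n
      rwa [show a - (c : ℤ) - 1 = a - (c + 1 : ℕ) by push_cast; ring,
        show a - (c : ℤ) + n = b + c by omega,
        show b + (c : ℤ) + 1 = b + (c + 1 : ℕ) by push_cast; ring] at this
  intro a b c d hab hbd heq
  obtain ⟨n, hn⟩ := Int.eq_ofNat_of_zero_le (show 0 ≤ b - a by omega)
  obtain ⟨m, hm⟩ := Int.eq_ofNat_of_zero_le (show 0 ≤ d - b by omega)
  rcases le_total b c with h | h
  · have := spread b c n h
    rwa [show b - (n : ℤ) = a by omega, show c + (n : ℤ) = d by omega] at this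
  · have := spread c b m h
    rw [mul_comm (f b)]
    rwa [show c - (m : ℤ) = a by omega, show b + (m : ℤ) = d by omega] at this

/-- A discrete Chebyshev inequality, from the Cauchy–Binet identity. -/
theorem sum_mul_sum_le_of_minors_nonneg (K : Finset ℤ) (u v s t : ℤ → ℝ)
    (huv : ∀ m n, m < n → u n * v m ≤ u m * v n) (hst : ∀ m n, m < n → s n * t m ≤ s m * t n) :
    (∑ m ∈ K, u m * t m) * (∑ n ∈ K, v n * s n) ≤ (∑ m ∈ K, u m * s m) * (∑ n ∈ K, v n * t n) := by
  have h : 0 ≤ ∑ m ∈ K, ∑ n ∈ K, (u m * v n - u n * v m) * (s m * t n - s n * t m) := by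
    refine Finset.sum_nonneg fun m _ => Finset.sum_nonneg fun n _ => ?_
    rcases lt_trichotomy m n with h | h | h
    · exact mul_nonneg (by linarith [huv m n h]) (by linarith [hst m n h])
    · subst h; simp
    · exact mul_nonneg_of_nonpos_of_nonpos (by linarith [huv n m h]) (by linarith [hst n m h])
  have e : ∑ m ∈ K, ∑ n ∈ K, (u m * v n - u n * v m) * (s m * t n - s n * t m)
      = 2 * ((∑ m ∈ K, u m * s m) * (∑ n ∈ K, v n * t n)
        - (∑ m ∈ K, u m * t m) * (∑ n ∈ K, v n * s n)) := by
    have e1 : ∀ m n, (u m * v n - u n * v m) * (s m * t n - s n * t m)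
        = (u m * s m) * (v n * t n) - (u m * t m) * (v n * s n)
          - (v m * s m) * (u n * t n) + (v m * t m) * (u n * s n) := fun m n => by ring
    simp only [e1, Finset.sum_add_distrib, Finset.sum_sub_distrib, ← Finset.sum_mul_sum]
    ring
  linarith

/-- Total positivity of order two passes to products of Toeplitz kernels, by Cauchy–Binet. -/
theorem IsTotallyLogConcave.conv {f g : ℤ → ℝ} (hf : IsTotallyLogConcave f)
    (hg : IsTotallyLogConcave g) (J : Finset ℤ) (hJ : ∀ x, x ∉ J → g x = 0) :
    IsTotallyLogConcave fun r => ∑ j ∈ J, g j * f (r - j) := by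
  classical
  have shift : ∀ (K : Finset ℤ) (r k : ℤ), (∀ j ∈ J, j + k ∈ K) →
      ∑ j ∈ J, g j * f (r - j) = ∑ m ∈ K, f (r + k - m) * g (m - k) := by
    intro K r k hK
    have : ∑ m ∈ J.image (· + k), f (r + k - m) * g (m - k)
        = ∑ m ∈ K, f (r + k - m) * g (m - k) := by
      refine Finset.sum_subset ?_ ?_
      · intro m hm
        obtain ⟨j, hj, rfl⟩ := Finset.mem_image.1 hm
        exact hK j hj
      · intro m _ hm
        rw [hJ (m - k), mul_zero]
        exact fun h => hm (Finset.mem_image.2 ⟨m - k, h, by ring⟩)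
    rw [← this, Finset.sum_image (fun x _ y _ h => by simpa using h)]
    refine Finset.sum_congr rfl fun j _ => ?_
    rw [mul_comm]
    congr 2 <;> ring
  intro a b c d hab hbd heq
  -- Shifting the sums at `a` and `c` by `b - a` leaves only the factors `f (b - m)` and `f (d -
  -- m)`, paired with `g` and its translate; `K` is a common index set for all four sums.
  set K := J ∪ J.image (· + (b - a)) with hK
  have h0 : ∀ j ∈ J, j + 0 ∈ K := fun j hj => by simp [hK, hj]
  have h1 : ∀ j ∈ J, j + (b - a) ∈ K := fun j hj => by
    simp only [hK, Finset.mem_union, Finset.mem_image]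
    exact Or.inr ⟨j, hj, rfl⟩
  show (∑ j ∈ J, g j * f (a - j)) * (∑ j ∈ J, g j * f (d - j)) ≤
    (∑ j ∈ J, g j * f (b - j)) * (∑ j ∈ J, g j * f (c - j))
  rw [shift K a _ h1, shift K d _ h0, shift K b _ h0, shift K c _ h1]
  have e1 : a + (b - a) = b := by ring
  have e2 : c + (b - a) = d := by omega
  simp only [e1, e2, add_zero, sub_zero]
  refine sum_mul_sum_le_of_minors_nonneg K (fun m => f (b - m)) (fun m => f (d - m)) g
    (fun m => g (m - (b - a))) ?_ ?_
  · intro m n hmn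
    exact hf _ _ _ _ (by omega) (by omega) (by omega)
  · intro m n hmn
    rw [mul_comm]
    exact hg _ _ _ _ (by omega) (by omega) (by omega)

/-! ### Stochastic order and quantile functions -/

/-- Likelihood-ratio order implies stochastic order. -/
theorem sum_filter_le_mul_sum_le (K : Finset ℤ) (p q : ℤ → ℝ)
    (h : ∀ x y, x < y → q x * p y ≤ p x * q y) (i : ℤ) :
    (∑ x ∈ K with x ≤ i, q x) * (∑ x ∈ K, p x) ≤ (∑ x ∈ K with x ≤ i, p x) * (∑ x ∈ K, q x) := by
  rw [← Finset.sum_filter_add_sum_filter_not K (· ≤ i) p,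
    ← Finset.sum_filter_add_sum_filter_not K (· ≤ i) q, mul_add, mul_add,
    mul_comm (∑ x ∈ K with x ≤ i, q x) (∑ x ∈ K with x ≤ i, p x)]
  gcongr 1
  rw [Finset.sum_mul_sum, Finset.sum_mul_sum]
  refine Finset.sum_le_sum fun x hx => Finset.sum_le_sum fun y hy => h x y ?_
  simp only [Finset.mem_filter] at hx hy
  omega

/-- The uniform distribution on the half-open unit interval. -/
noncomputable def uniformIoc : Measure (Set.Ioc (0 : ℝ) 1) := Measure.comap Subtype.val volume

theorem uniformIoc_le {c : ℝ} (h1 : c ≤ 1) :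
    uniformIoc {u : Set.Ioc (0 : ℝ) 1 | (u : ℝ) ≤ c} = ENNReal.ofReal c := by
  have e : Subtype.val '' {u : Set.Ioc (0 : ℝ) 1 | (u : ℝ) ≤ c} = Set.Ioc 0 c := by
    ext x
    simp only [Set.mem_image, Set.mem_ofPred_eq, Subtype.exists, Set.mem_Ioc, exists_and_left,
      exists_prop, exists_eq_right_right]
    constructor
    · rintro ⟨h, h', -⟩; exact ⟨h', h⟩
    · rintro ⟨h, h'⟩; exact ⟨h', h, h'.trans h1⟩
  rw [uniformIoc, comap_subtype_coe_apply measurableSet_Ioc, e]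
  simp

instance isProbabilityMeasure_uniformIoc : IsProbabilityMeasure uniformIoc where
  measure_univ := by
    rw [← ENNReal.ofReal_one, ← uniformIoc_le le_rfl]
    congr 1
    ext u
    simpa using u.2.2

theorem uniformIoc_real_le {c : ℝ} (h0 : 0 ≤ c) (h1 : c ≤ 1) :
    uniformIoc.real {u : Set.Ioc (0 : ℝ) 1 | (u : ℝ) ≤ c} = c := by
  rw [Measure.real, uniformIoc_le h1, ENNReal.toReal_ofReal h0]

/-- The quantile function of a finitely supported probability mass function on the integers. -/
theorem exists_quantile (J : Finset ℤ) (p : ℤ → ℝ) (hp : ∀ x, 0 ≤ p x)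
    (hsum : ∑ x ∈ J, p x = 1) :
    ∃ B : Set.Ioc (0 : ℝ) 1 → ℤ, Measurable B ∧
      (∀ u i, B u ≤ i ↔ (u : ℝ) ≤ ∑ x ∈ J with x ≤ i, p x) ∧
      (∀ u, B u ∈ J ∧ 0 < p (B u)) ∧
      ∀ j ∈ J, uniformIoc.real {u | B u = j} = p j := by
  classical
  set F : ℤ → ℝ := fun i => ∑ x ∈ J with x ≤ i, p x with hF
  have Fmono : Monotone F := fun i k hik => by
    refine Finset.sum_le_sum_of_subset_of_nonneg ?_ fun x _ _ => hp x
    intro x hx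
    simp only [Finset.mem_filter] at hx ⊢
    exact ⟨hx.1, hx.2.trans hik⟩
  have F0 : ∀ i, 0 ≤ F i := fun i => Finset.sum_nonneg fun x _ => hp x
  have F1 : ∀ i, F i ≤ 1 := fun i => by
    rw [← hsum]
    exact Finset.sum_le_sum_of_subset_of_nonneg (Finset.filter_subset _ _) fun x _ _ => hp x
  have hstep : ∀ j, F j = F (j - 1) + if j ∈ J then p j else 0 := by
    intro j
    simp only [hF, Finset.sum_filter]
    rw [← Finset.sum_ite_eq' J j p, ← Finset.sum_add_distrib]
    refine Finset.sum_congr rfl fun x _ => ?_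
    rcases lt_trichotomy x j with h | h | h
    · rw [if_pos h.le, if_pos (by omega), if_neg h.ne, add_zero]
    · subst h; simp
    · rw [if_neg (by omega), if_neg (by omega), if_neg h.ne', add_zero]
  obtain ⟨lo, hlo⟩ := J.bddBelow
  obtain ⟨hi, hhi⟩ := J.bddAbove
  have Flo : ∀ i, i < lo → F i = 0 := fun i hi => by
    simp only [hF]
    rw [Finset.filter_false_of_mem, Finset.sum_empty]
    intro x hx
    have := hlo hx
    omega
  have Fhi : F hi = 1 := by
    simp only [hF]
    rw [Finset.filter_true_of_mem (fun x hx => hhi hx), hsum]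
  -- The half-open interval makes every quantile finite: `u ≤ 1` gives nonemptiness, `0 < u` the
  -- lower bound.
  have hne : ∀ u : Set.Ioc (0 : ℝ) 1, {i | (u : ℝ) ≤ F i}.Nonempty := fun u =>
    ⟨hi, by simpa [Fhi] using u.2.2⟩
  have hbdd : ∀ u : Set.Ioc (0 : ℝ) 1, BddBelow {i | (u : ℝ) ≤ F i} := fun u =>
    ⟨lo, fun i (hi : (u : ℝ) ≤ F i) => by
      by_contra h
      rw [Flo i (not_le.1 h)] at hi
      exact absurd u.2.1 (not_lt.2 hi)⟩
  have gal : ∀ (u : Set.Ioc (0 : ℝ) 1) i, sInf {i | (u : ℝ) ≤ F i} ≤ i ↔ (u : ℝ) ≤ F i := by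
    intro u i
    constructor
    · intro h
      exact le_trans (Int.csInf_mem (hne u) (hbdd u)) (Fmono h)
    · intro h
      exact csInf_le (hbdd u) h
  have hmeas : Measurable fun u : Set.Ioc (0 : ℝ) 1 => sInf {i | (u : ℝ) ≤ F i} := by
    refine measurable_of_Iic fun i => ?_
    have : (fun u : Set.Ioc (0 : ℝ) 1 => sInf {i | (u : ℝ) ≤ F i}) ⁻¹' Set.Iic i
        = {u : Set.Ioc (0 : ℝ) 1 | (u : ℝ) ≤ F i} := by
      ext u; exact gal u i
    rw [this]
    exact measurableSet_le measurable_subtype_coe measurable_const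
  refine ⟨fun u => sInf {i | (u : ℝ) ≤ F i}, hmeas, gal, ?_, ?_⟩
  · intro u
    have h1 := (gal u _).1 le_rfl
    have h2 := mt (gal u (sInf {i | (u : ℝ) ≤ F i} - 1)).2 (by omega)
    rw [hstep] at h1
    split_ifs at h1 with h
    · exact ⟨h, by linarith⟩
    · exact absurd h1 (by linarith)
  · intro j hj
    have e : {u : Set.Ioc (0 : ℝ) 1 | sInf {i | (u : ℝ) ≤ F i} = j}
        = {u : Set.Ioc (0 : ℝ) 1 | (u : ℝ) ≤ F j} \
          {u : Set.Ioc (0 : ℝ) 1 | (u : ℝ) ≤ F (j - 1)} := by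
      ext u
      simp only [Set.mem_sdiff, Set.mem_ofPred_eq]
      rw [← gal, ← gal]
      omega
    rw [e, measureReal_sdiff, uniformIoc_real_le (F0 _) (F1 _), uniformIoc_real_le (F0 _) (F1 _),
      hstep j, if_pos hj]
    · ring
    · exact fun u (hu : (u : ℝ) ≤ F (j - 1)) => hu.trans (Fmono (by omega))
    · exact measurableSet_le measurable_subtype_coe measurable_const

/-! ### Monotone couplings and mixtures -/

/-- `g` is a mixture of push-forwards of the mass function `w`, supported on the finite set `S`,
under maps which are strictly increasing on `S`. -/
def IsMonoMixture (S : Finset ℤ) (w g : ℤ → ℝ) : Prop :=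
  ∃ (Λ : Type) (_ : MeasurableSpace Λ) (μ : Measure Λ) (_ : IsProbabilityMeasure μ)
    (T : Λ → ℤ → ℤ), (∀ r, Measurable fun l => T l r) ∧ (∀ l, StrictMonoOn (T l) S) ∧
      ∀ a, g a = ∑ r ∈ S, w r * μ.real {l | T l r = a}

/-- The conditional distributions of `Y` given `X + Y = r`, for independent log-concave `X` and `Y`,
admit a coupling in which both `Y` and `X` increase with `r`. -/
theorem exists_monotone_coupling {f g w : ℤ → ℝ} {I J S : Finset ℤ}
    (hf0 : ∀ x, 0 ≤ f x) (hg0 : ∀ x, 0 ≤ g x)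
    (hI : ∀ x, x ∈ I ↔ 0 < f x) (hJ : ∀ x, x ∈ J ↔ 0 < g x) (hS : ∀ x, x ∈ S ↔ 0 < w x)
    (hf : IsTotallyLogConcave f) (hg : IsTotallyLogConcave g)
    (hw : ∀ r, w r = ∑ j ∈ J, g j * f (r - j)) :
    ∃ B : ℤ → Set.Ioc (0 : ℝ) 1 → ℤ, (∀ r, Measurable (B r)) ∧
      (∀ r ∈ S, ∀ u, B r u ∈ J ∧ r - B r u ∈ I) ∧
      (∀ r ∈ S, ∀ j ∈ J, w r * uniformIoc.real {u | B r u = j} = g j * f (r - j)) ∧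
      ∀ r ∈ S, ∀ r' ∈ S, r < r' → ∀ u, B r u ≤ B r' u ∧ B r' u ≤ B r u + (r' - r) := by
  classical
  have hJ0 : ∀ x, x ∉ J → g x = 0 := fun x hx =>
    le_antisymm (not_lt.1 (mt (hJ x).2 hx)) (hg0 x)
  have quantile : ∀ r, ∃ B : Set.Ioc (0 : ℝ) 1 → ℤ, Measurable B ∧ (r ∈ S →
      (∀ u i, B u ≤ i ↔ (u : ℝ) ≤ (∑ x ∈ J with x ≤ i, g x * f (r - x)) / w r) ∧
      (∀ u, B u ∈ J ∧ r - B u ∈ I) ∧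
      ∀ j ∈ J, w r * uniformIoc.real {u | B u = j} = g j * f (r - j)) := by
    intro r
    by_cases hr : r ∈ S
    swap
    -- Off `S` there is no conditional law, so any measurable value will do.
    · exact ⟨fun _ => 0, measurable_const, fun h => absurd h hr⟩
    have hwr := (hS r).1 hr
    obtain ⟨B, h1, h2, h3, h4⟩ := exists_quantile J (fun x => g x * f (r - x) / w r)
      (fun x => div_nonneg (mul_nonneg (hg0 _) (hf0 _)) hwr.le)
      (by rw [← Finset.sum_div, ← hw, div_self hwr.ne'])
    refine ⟨B, h1, fun _ => ⟨fun u i => ?_, fun u => ⟨(h3 u).1, ?_⟩, fun j hj => ?_⟩⟩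
    · rw [h2, Finset.sum_div]
    · rw [hI]
      refine lt_of_le_of_ne (hf0 _) fun h => (h3 u).2.ne ?_
      simp [← h]
    · rw [h4 j hj, mul_div_cancel₀ _ hwr.ne']
  choose B hB hBS using quantile
  refine ⟨B, hB, fun r hr => (hBS r hr).2.1, fun r hr => (hBS r hr).2.2, ?_⟩
  intro r hr r' hr' hlt u
  have hwr := (hS r).1 hr
  have hwr' := (hS r').1 hr'
  have gal := (hBS r hr).1
  have gal' := (hBS r' hr').1
  constructor
  -- The quantile functions share the same `u`, so stochastic order gives pointwise order. The
  -- likelihood ratio `f (r' - x) / f (r - x)` increases in `x` by log-concavity of `f`.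
  · rw [gal]
    refine ((gal' u _).1 le_rfl).trans ?_
    rw [div_le_div_iff₀ hwr' hwr, hw r, hw r']
    refine sum_filter_le_mul_sum_le J (fun x => g x * f (r - x)) (fun x => g x * f (r' - x)) ?_ _
    intro x y hxy
    have := hf (r - y) (r - x) (r' - y) (r' - x) (by omega) (by omega) (by omega)
    have := mul_le_mul_of_nonneg_left this (mul_nonneg (hg0 x) (hg0 y))
    linarith
  -- Here `B r' - d` is compared with `B r`: after translation by `d` the factors of `f` agree, and
  -- log-concavity of `g` orders the laws.
  · rw [gal']
    refine ((gal u _).1 le_rfl).trans ?_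
    generalize B r u = i
    set d := r' - r with hd
    set K := J ∪ J.image (· - d) with hK
    have restrict : ∀ (P : ℤ → Prop) [DecidablePred P],
        ∑ x ∈ J with P x, g x * f (r - x) = ∑ x ∈ K with P x, g x * f (r - x) := by
      intro P _
      refine Finset.sum_subset (Finset.filter_subset_filter _ Finset.subset_union_left) ?_
      intro x hx hx'
      rw [hJ0 x, zero_mul]
      simp only [Finset.mem_filter] at hx hx'
      tauto
    have shift : ∀ (P : ℤ → Prop) [DecidablePred P],
        ∑ x ∈ J with P x, g x * f (r' - x)
          = ∑ x ∈ K with P (x + d), g (x + d) * f (r - x) := by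
      intro P _
      have : ∑ x ∈ (J.filter P).image (· - d), g (x + d) * f (r - x)
          = ∑ x ∈ K with P (x + d), g (x + d) * f (r - x) := by
        refine Finset.sum_subset ?_ ?_
        · intro x hx
          obtain ⟨y, hy, rfl⟩ := Finset.mem_image.1 hx
          rw [Finset.mem_filter] at hy
          rw [Finset.mem_filter, hK, Finset.mem_union, Finset.mem_image, sub_add_cancel]
          exact ⟨Or.inr ⟨y, hy.1, rfl⟩, hy.2⟩
        · intro x hx hx'
          rw [hJ0 (x + d), zero_mul]
          intro h
          rw [Finset.mem_filter] at hx
          exact hx' (Finset.mem_image.2 ⟨x + d, Finset.mem_filter.2 ⟨h, hx.2⟩, by ring⟩)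
      rw [← this, Finset.sum_image (fun x _ y _ h => by simpa using h)]
      refine Finset.sum_congr rfl fun x _ => ?_
      rw [sub_add_cancel, show r - (x - d) = r' - x by omega]
    have tot : w r = ∑ x ∈ K, g x * f (r - x) := by
      have := restrict (fun _ => True)
      simpa [← hw] using this
    have tot' : w r' = ∑ x ∈ K, g (x + d) * f (r - x) := by
      have := shift (fun _ => True)
      simpa [← hw] using this
    have hfil : (K.filter fun x => x + d ≤ i + d) = K.filter fun x => x ≤ i := by
      refine Finset.filter_congr fun x _ => ?_
      omega
    rw [restrict, shift, hfil, div_le_div_iff₀ hwr hwr', tot, tot']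
    refine sum_filter_le_mul_sum_le K (fun x => g (x + d) * f (r - x))
      (fun x => g x * f (r - x)) ?_ _
    intro x y hxy
    have := hg x (x + d) y (y + d) (by omega) (by omega) (by omega)
    have := mul_le_mul_of_nonneg_right this (mul_nonneg (hf0 (r - x)) (hf0 (r - y)))
    linarith

/-- The new random map sends `r` to `T (r - B r) + t (B r)`, with `T` independent of the coupling
`B`. -/
theorem IsMonoMixture.conv {f g w g₁ h : ℤ → ℝ} {I J S : Finset ℤ}
    (hf0 : ∀ x, 0 ≤ f x) (hg0 : ∀ x, 0 ≤ g x)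
    (hI : ∀ x, x ∈ I ↔ 0 < f x) (hJ : ∀ x, x ∈ J ↔ 0 < g x) (hS : ∀ x, x ∈ S ↔ 0 < w x)
    (hf : IsTotallyLogConcave f) (hg : IsTotallyLogConcave g)
    (hw : ∀ r, w r = ∑ j ∈ J, g j * f (r - j)) (hmix : IsMonoMixture I f g₁)
    (t : ℤ → ℤ) (ht : StrictMonoOn t J) (hh : ∀ a, h a = ∑ j ∈ J, g j * g₁ (a - t j)) :
    IsMonoMixture S w h := by
  classical
  obtain ⟨Λ, _, μ, _, T, hTm, hT, hg₁⟩ := hmix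
  obtain ⟨B, hBm, hBmem, hBlaw, hBmono⟩ := exists_monotone_coupling hf0 hg0 hI hJ hS hf hg hw
  have hTmeas : ∀ r, Measurable fun l : Λ × Set.Ioc (0 : ℝ) 1 =>
      T l.1 (r - B r l.2) + t (B r l.2) := by
    intro r
    have : Measurable fun q : Λ × ℤ => T q.1 (r - q.2) + t q.2 :=
      measurable_from_prod_countable_left fun b => (hTm (r - b)).add_const (t b)
    exact this.comp (measurable_fst.prodMk ((hBm r).comp measurable_snd))
  refine ⟨Λ × Set.Ioc (0 : ℝ) 1, inferInstance, μ.prod uniformIoc, inferInstance,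
    fun l r => T l.1 (r - B r l.2) + t (B r l.2), hTmeas, ?_, ?_⟩
  · rintro ⟨l, u⟩ r hr r' hr' hlt
    obtain ⟨h1, h2⟩ := hBmono r hr r' hr' hlt u
    obtain ⟨m1, m2⟩ := hBmem r hr u
    obtain ⟨m1', m2'⟩ := hBmem r' hr' u
    show T l (r - B r u) + t (B r u) < T l (r' - B r' u) + t (B r' u)
    -- Of the two nondecreasing parts `B r` and `r - B r`, at least one increases strictly.
    rcases h1.eq_or_lt with e | h1
    · have a1 := hT l m2 m2' (by omega)
      rw [e] at a1 ⊢
      omega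
    · have a1 := (hT l).monotoneOn m2 m2' (by omega)
      have a2 := ht m1 m1' h1
      omega
  · intro a
    have hlaw : ∀ r ∈ S, w r * (μ.prod uniformIoc).real
        {l | T l.1 (r - B r l.2) + t (B r l.2) = a}
        = ∑ j ∈ J, g j * (f (r - j) * μ.real {l | T l (r - j) = a - t j}) := by
      intro r hr
      have e : {l : Λ × Set.Ioc (0 : ℝ) 1 | T l.1 (r - B r l.2) + t (B r l.2) = a}
          = ⋃ j ∈ J, {l | T l (r - j) = a - t j} ×ˢ {u | B r u = j} := by
        ext ⟨l, u⟩
        simp only [Set.mem_ofPred_eq, Set.mem_iUnion, Set.mem_prod, exists_prop]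
        constructor
        · intro hl
          exact ⟨B r u, (hBmem r hr u).1, by omega, rfl⟩
        · rintro ⟨j, _, hl, rfl⟩
          omega
      have m1 : ∀ j, MeasurableSet {l | T l (r - j) = a - t j} := fun j =>
        hTm (r - j) (measurableSet_singleton _)
      have m2 : ∀ j, MeasurableSet {u | B r u = j} := fun j => hBm r (measurableSet_singleton _)
      rw [e, measureReal_biUnion_finset, Finset.mul_sum]
      · refine Finset.sum_congr rfl fun j hj => ?_
        rw [measureReal_prod_prod, ← mul_assoc (g j), ← hBlaw r hr j hj]
        ring
      · intro j _ k _ hjk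
        refine Set.disjoint_left.2 fun x hx hx' => hjk ?_
        exact hx.2.symm.trans hx'.2
      · exact fun j _ => (m1 j).prod (m2 j)
    show h a = ∑ r ∈ S, w r * (μ.prod uniformIoc).real
        {l | T l.1 (r - B r l.2) + t (B r l.2) = a}
    rw [Finset.sum_congr rfl hlaw, Finset.sum_comm, hh]
    refine Finset.sum_congr rfl fun j hj => ?_
    rw [hg₁, ← Finset.mul_sum]
    congr 1
    -- For fixed `j`, the terms of the sum over `S` vanish outside `I + j`, so it reduces to the
    -- mixture formula for `g₁`.
    have hsub : I.image (· + j) ⊆ S := by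
      intro r hr
      obtain ⟨i, hi, rfl⟩ := Finset.mem_image.1 hr
      rw [hS, hw]
      refine Finset.sum_pos' (fun k _ => mul_nonneg (hg0 _) (hf0 _)) ⟨j, hj, ?_⟩
      rw [add_sub_cancel_right]
      exact mul_pos ((hJ j).1 hj) ((hI i).1 hi)
    rw [← Finset.sum_subset hsub, Finset.sum_image (fun x _ y _ h => by simpa using h)]
    · simp only [add_sub_cancel_right]
    · intro r _ hr
      have : f (r - j) = 0 := by
        refine le_antisymm (not_lt.1 fun hpos => hr ?_) (hf0 _)
        exact Finset.mem_image.2 ⟨r - j, (hI _).2 hpos, by ring⟩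
      rw [this, zero_mul]

/-! ### Majorization and Rényi entropy -/

/-- Take `M r a = μ(T r = a)`. For fixed `a` these events are disjoint in `r` because `T` is
injective on `S`, which bounds the column sums. -/
theorem IsMonoMixture.exists_substochastic {S G : Finset ℤ} {w g : ℤ → ℝ}
    (hmix : IsMonoMixture S w g) (hS : ∀ x, x ∈ S ↔ 0 < w x) (hG : ∀ a, a ∈ G ↔ 0 < g a) :
    ∃ M : ℤ → ℤ → ℝ, (∀ r a, 0 ≤ M r a) ∧ (∀ r ∈ S, ∑ a ∈ G, M r a = 1) ∧
      (∀ a, ∑ r ∈ S, M r a ≤ 1) ∧ ∀ a, g a = ∑ r ∈ S, M r a * w r := by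
  obtain ⟨Λ, _, μ, _, T, hTm, hT, hg⟩ := hmix
  have hmeas : ∀ r a, MeasurableSet {l | T l r = a} := fun r a =>
    hTm r (measurableSet_singleton a)
  refine ⟨fun r a => μ.real {l | T l r = a}, fun r a => measureReal_nonneg, ?_, ?_, ?_⟩
  · intro r hr
    -- As `w r > 0`, an image point of positive probability has positive `g`-mass.
    have hnull : ∀ a, a ∉ G → μ {l | T l r = a} = 0 := by
      intro a ha
      rw [hG, not_lt, hg] at ha
      have h1 := Finset.single_le_sum (f := fun r => w r * μ.real {l | T l r = a})
        (fun x hx => mul_nonneg ((hS x).1 hx).le measureReal_nonneg) hr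
      have h2 : μ.real {l | T l r = a} ≤ 0 :=
        nonpos_of_mul_nonpos_right (h1.trans ha) ((hS r).1 hr)
      exact (measureReal_eq_zero_iff).1 (le_antisymm h2 measureReal_nonneg)
    rw [← measureReal_biUnion_finset]
    · have hae : ∀ᵐ l ∂μ, l ∈ ⋃ a ∈ G, {l | T l r = a} := by
        have : ∀ a : ℤ, ∀ᵐ l ∂μ, a ∉ G → T l r ≠ a := by
          intro a
          by_cases ha : a ∈ G
          · exact Filter.Eventually.of_forall fun l h => absurd ha h
          · have := measure_eq_zero_iff_ae_notMem.1 (hnull a ha)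
            filter_upwards [this] with l hl _ using hl
        filter_upwards [ae_all_iff.2 this] with l hl
        simp only [Set.mem_iUnion, Set.mem_ofPred_eq, exists_prop]
        refine ⟨T l r, ?_, rfl⟩
        by_contra h
        exact hl _ h rfl
      have huniv : (⋃ a ∈ G, {l | T l r = a}) =ᵐ[μ] Set.univ := Filter.eventuallyEq_univ.2 hae
      rw [measureReal_congr huniv, probReal_univ]
    · intro a _ b _ hab
      exact Set.disjoint_left.2 fun l hl hl' => hab (hl.symm.trans hl')
    · exact fun a _ => hmeas r a
  · intro a
    rw [← measureReal_biUnion_finset]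
    · exact measureReal_le_one
    · intro r hr r' hr' hne
      exact Set.disjoint_left.2 fun l hl hl' => hne ((hT l).injOn hr hr' (hl.trans hl'.symm))
    · exact fun r _ => hmeas r a
  · intro a
    rw [hg]
    exact Finset.sum_congr rfl fun r _ => mul_comm _ _

/-- Jensen's inequality for doubly substochastic matrices. -/
theorem sum_convex_le_of_substochastic {S G : Finset ℤ} {w g : ℤ → ℝ} {M : ℤ → ℤ → ℝ}
    (hw0 : ∀ x, 0 ≤ w x) (hM0 : ∀ r a, 0 ≤ M r a) (hrow : ∀ r ∈ S, ∑ a ∈ G, M r a = 1)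
    (hcol : ∀ a, ∑ r ∈ S, M r a ≤ 1) (hg : ∀ a, g a = ∑ r ∈ S, M r a * w r)
    {φ : ℝ → ℝ} (hφ : ConvexOn ℝ (Set.Ici 0) φ) (hφ0 : φ 0 = 0) :
    ∑ a ∈ G, φ (g a) ≤ ∑ r ∈ S, φ (w r) := by
  calc ∑ a ∈ G, φ (g a) ≤ ∑ a ∈ G, ∑ r ∈ S, M r a * φ (w r) := by
        refine Finset.sum_le_sum fun a _ => ?_
        -- The missing column mass is placed at 0, where `φ` vanishes.
        have := hφ.map_add_sum_le (t := S) (w := fun r => M r a) (p := w)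
          (v := 1 - ∑ r ∈ S, M r a) (q := 0) (fun r _ => hM0 r a) (by ring) (fun r _ => hw0 r)
          (by linarith [hcol a]) (Set.mem_Ici.2 le_rfl)
        simpa [hφ0, hg] using this
    _ = ∑ r ∈ S, φ (w r) := by
        rw [Finset.sum_comm]
        refine Finset.sum_congr rfl fun r hr => ?_
        rw [← Finset.sum_mul, hrow r hr, one_mul]

/-- Order 0 counts the entries of `M`, and order ∞ bounds subconvex averages by the supremum. For
other orders Jensen is applied to `x log x`, `-x^α` or `x^α`; the sign of `1 / (1 - α)` matches the
change of convexity at 1. -/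
theorem IsMonoMixture.renyiEntropyOfMass_le {S G : Finset ℤ} {w g : ℤ → ℝ}
    (hmix : IsMonoMixture S w g) (hw0 : ∀ x, 0 ≤ w x) (hg0 : ∀ x, 0 ≤ g x)
    (hS : ∀ x, x ∈ S ↔ 0 < w x) (hG : ∀ a, a ∈ G ↔ 0 < g a) (hne : S.Nonempty) (α : ℝ≥0∞) :
    renyiEntropyOfMass α w ≤ renyiEntropyOfMass α g := by
  obtain ⟨M, hM0, hrow, hcol, hg⟩ := hmix.exists_substochastic hS hG
  have jensen {φ : ℝ → ℝ} (hφ : ConvexOn ℝ (Set.Ici 0) φ) (hφ0 : φ 0 = 0) :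
      ∑ a ∈ G, φ (g a) ≤ ∑ r ∈ S, φ (w r) :=
    sum_convex_le_of_substochastic hw0 hM0 hrow hcol hg hφ hφ0
  have hSw : ∀ x, x ∉ S → w x = 0 := fun x hx =>
    le_antisymm (not_lt.1 (mt (hS x).2 hx)) (hw0 x)
  have hGg : ∀ x, x ∉ G → g x = 0 := fun x hx =>
    le_antisymm (not_lt.1 (mt (hG x).2 hx)) (hg0 x)
  have hGne : G.Nonempty := by
    obtain ⟨r, hr⟩ := hne
    rw [Finset.nonempty_iff_ne_empty]
    rintro rfl
    simpa using hrow r hr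
  unfold renyiEntropyOfMass
  split_ifs with h0 h1 h2
  · have eS : posSupp w = S := Set.ext fun x => (hS x).symm
    have eG : posSupp g = G := Set.ext fun x => (hG x).symm
    rw [eS, eG, Set.ncard_coe_finset, Set.ncard_coe_finset]
    refine Real.log_le_log (by exact_mod_cast hne.card_pos) ?_
    calc (S.card : ℝ) = ∑ r ∈ S, ∑ a ∈ G, M r a := by
          rw [Finset.sum_congr rfl hrow]; simp
      _ = ∑ a ∈ G, ∑ r ∈ S, M r a := Finset.sum_comm
      _ ≤ ∑ a ∈ G, 1 := Finset.sum_le_sum fun a _ => hcol a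
      _ = G.card := by simp
  · rw [tsum_eq_sum (s := S) (fun x hx => by simp [hSw x hx]),
      tsum_eq_sum (s := G) (fun x hx => by simp [hGg x hx]), Finset.sum_neg_distrib,
      Finset.sum_neg_distrib, neg_le_neg_iff]
    exact jensen Real.convexOn_mul_log (by simp)
  · have hbw : BddAbove (Set.range w) := by
      refine ⟨∑ r ∈ S, w r, ?_⟩
      rintro _ ⟨r, rfl⟩
      by_cases hr : r ∈ S
      · exact Finset.single_le_sum (fun x _ => hw0 x) hr
      · rw [hSw r hr]; exact Finset.sum_nonneg fun x _ => hw0 x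
    have hle : ∀ a, g a ≤ ⨆ i, w i := by
      intro a
      calc g a ≤ ∑ r ∈ S, M r a * ⨆ i, w i := by
            rw [hg]
            exact Finset.sum_le_sum fun r _ =>
              mul_le_mul_of_nonneg_left (le_ciSup hbw r) (hM0 r a)
        _ = (∑ r ∈ S, M r a) * ⨆ i, w i := (Finset.sum_mul _ _ _).symm
        _ ≤ 1 * ⨆ i, w i :=
            mul_le_mul_of_nonneg_right (hcol a) (Real.iSup_nonneg hw0)
        _ = _ := one_mul _
    obtain ⟨a, ha⟩ := hGne
    have hpos : 0 < ⨆ i, g i :=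
      ((hG a).1 ha).trans_le (le_ciSup (f := g) ⟨_, Set.forall_mem_range.2 hle⟩ a)
    exact neg_le_neg (Real.log_le_log hpos (ciSup_le hle))
  · have hα0 : 0 < α.toReal := ENNReal.toReal_pos h0 h2
    have hα1 : α.toReal ≠ 1 := fun h => h1 ((ENNReal.toReal_eq_one_iff α).1 h)
    rw [tsum_eq_sum (s := S) (fun x hx => by simp [hSw x hx, hα0.ne']),
      tsum_eq_sum (s := G) (fun x hx => by simp [hGg x hx, hα0.ne'])]
    have hposS : 0 < ∑ r ∈ S, w r ^ α.toReal :=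
      Finset.sum_pos (fun r hr => Real.rpow_pos_of_pos ((hS r).1 hr) _) hne
    have hposG : 0 < ∑ a ∈ G, g a ^ α.toReal :=
      Finset.sum_pos (fun r hr => Real.rpow_pos_of_pos ((hG r).1 hr) _) hGne
    rcases lt_or_gt_of_ne hα1 with hlt | hgt
    · refine mul_le_mul_of_nonneg_left (Real.log_le_log hposS ?_)
        (one_div_nonneg.2 (by linarith))
      have := jensen (Real.concaveOn_rpow hα0.le hlt.le).neg (by simp [hα0.ne'])
      simpa using this
    · refine mul_le_mul_of_nonpos_left (Real.log_le_log hposG ?_)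
        (one_div_nonpos.2 (by linarith))
      exact jensen (convexOn_rpow hgt.le) (by simp [hα0.ne'])

/-! ### Mass functions of sums, and the squeezed rearrangement -/

theorem massFun_nonneg {Ω : Type*} [MeasurableSpace Ω] (P : Measure Ω) (X : Ω → ℤ) (k : ℤ) :
    0 ≤ massFun P X k := measureReal_nonneg

theorem ae_mem_posSupp {Ω : Type*} [MeasurableSpace Ω] (P : Measure Ω) [IsProbabilityMeasure P]
    (X : Ω → ℤ) : ∀ᵐ ω ∂P, X ω ∈ posSupp (massFun P X) := by
  have : ∀ k : ℤ, ∀ᵐ ω ∂P, k ∉ posSupp (massFun P X) → X ω ≠ k := by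
    intro k
    by_cases hk : k ∈ posSupp (massFun P X)
    · exact Filter.Eventually.of_forall fun _ h => absurd hk h
    · have h0 : P.real (X ⁻¹' {k}) = 0 := le_antisymm (not_lt.1 hk) measureReal_nonneg
      have := measure_eq_zero_iff_ae_notMem.1 ((measureReal_eq_zero_iff).1 h0)
      filter_upwards [this] with ω hω _ using hω
  filter_upwards [ae_all_iff.2 this] with ω hω
  by_contra h
  exact hω _ h rfl

/-- The mass function of a sum of two independent random variables is a convolution. -/
theorem massFun_add {Ω : Type*} [MeasurableSpace Ω] (P : Measure Ω) [IsProbabilityMeasure P]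
    {X Y : Ω → ℤ} (hX : Measurable X) (hY : Measurable Y) (hXY : IndepFun X Y P) (J : Finset ℤ)
    (hJ : ∀ k, k ∈ J ↔ 0 < massFun P X k) (a : ℤ) :
    massFun P (fun ω => X ω + Y ω) a = ∑ j ∈ J, massFun P X j * massFun P Y (a - j) := by
  have hae : (fun ω => X ω + Y ω) ⁻¹' {a} =ᵐ[P] ⋃ j ∈ J, X ⁻¹' {j} ∩ Y ⁻¹' {a - j} := by
    filter_upwards [ae_mem_posSupp P X] with ω hω
    refine propext ?_
    show X ω + Y ω = a ↔ ω ∈ ⋃ j ∈ J, X ⁻¹' {j} ∩ Y ⁻¹' {a - j}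
    simp only [Set.mem_iUnion, Set.mem_inter_iff, Set.mem_preimage, Set.mem_singleton_iff,
      exists_prop]
    constructor
    · intro h
      exact ⟨X ω, (hJ _).2 hω, rfl, by omega⟩
    · rintro ⟨j, _, h1, h2⟩
      omega
  unfold massFun
  rw [measureReal_congr hae, measureReal_biUnion_finset]
  · refine Finset.sum_congr rfl fun j _ => ?_
    have := hXY.measure_inter_preimage_eq_mul {j} {a - j} (measurableSet_singleton _)
      (measurableSet_singleton _)
    simp only [Measure.real, this, ENNReal.toReal_mul]
  · intro j _ k _ hjk
    exact Set.disjoint_left.2 fun ω h h' => hjk (h.1.symm.trans h'.1)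
  · exact fun j _ => (hX (measurableSet_singleton _)).inter (hY (measurableSet_singleton _))

/-- The squeezed rearrangement `f^#` is obtained from `f` by an increasing reindexing of its support
by an initial segment of the natural numbers. -/
theorem exists_hashFun_reindex (f : ℤ → ℝ) (hf : (posSupp f).Finite) :
    ∃ t : ℤ → ℤ, StrictMonoOn t (Finset.Ico (0 : ℤ) hf.toFinset.card) ∧
      (Finset.Ico (0 : ℤ) hf.toFinset.card).image t = hf.toFinset ∧
      (∀ k ∈ Finset.Ico (0 : ℤ) hf.toFinset.card, hashFun f hf k = f (t k)) ∧
      ∀ k ∉ Finset.Ico (0 : ℤ) hf.toFinset.card, hashFun f hf k = 0 := by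
  set n := hf.toFinset.card with hn
  set e := hf.toFinset.orderEmbOfFin rfl with he
  let t : ℤ → ℤ := fun k => if h : k.toNat < n then e ⟨k.toNat, h⟩ else 0
  have ht : ∀ r : Fin n, t ((r : ℕ) : ℤ) = e r := fun r => by simp [t]
  have hlift : ∀ k ∈ Finset.Ico (0 : ℤ) n, ∃ r : Fin n, ((r : ℕ) : ℤ) = k := by
    intro k hk
    rw [Finset.mem_Ico] at hk
    exact ⟨⟨k.toNat, by omega⟩, by simp [hk.1]⟩
  have hmem : ∀ r : Fin n, ((r : ℕ) : ℤ) ∈ Finset.Ico (0 : ℤ) n := fun r => by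
    have := r.2
    rw [Finset.mem_Ico]
    omega
  refine ⟨t, ?_, ?_, ?_, ?_⟩
  · intro k hk k' hk' hlt
    obtain ⟨r, rfl⟩ := hlift k hk
    obtain ⟨r', rfl⟩ := hlift k' hk'
    rw [ht, ht]
    exact e.strictMono (by exact_mod_cast hlt)
  · ext x
    rw [Finset.mem_image]
    constructor
    · rintro ⟨k, hk, rfl⟩
      obtain ⟨r, rfl⟩ := hlift k hk
      rw [ht]
      exact Finset.orderEmbOfFin_mem _ _ _
    · intro hx
      have : x ∈ Set.range e := by
        rw [he, Finset.range_orderEmbOfFin]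
        exact hx
      obtain ⟨r, rfl⟩ := this
      exact ⟨_, hmem r, ht r⟩
  · intro k hk
    obtain ⟨r, rfl⟩ := hlift k hk
    rw [ht]
    unfold hashFun
    rw [Finset.sum_eq_single r]
    · rw [if_pos rfl]
    · intro b _ hb
      rw [if_neg]
      intro h
      exact hb (Fin.ext (by exact_mod_cast h.symm))
    · exact fun h => absurd (Finset.mem_univ r) h
  · intro k hk
    unfold hashFun
    refine Finset.sum_eq_zero fun r _ => if_neg ?_
    rintro rfl
    exact hk (hmem r)

/-- Squeezing removes internal zeros: the support becomes an initial segment. -/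
theorem IsHashLogConcave.isTotallyLogConcave {f : ℤ → ℝ} {hf : (posSupp f).Finite}
    (h : IsHashLogConcave f hf) : IsTotallyLogConcave (hashFun f hf) := by
  obtain ⟨t, -, ht, h1, h2⟩ := exists_hashFun_reindex f hf
  have hpos : ∀ k ∈ Finset.Ico (0 : ℤ) hf.toFinset.card, 0 < hashFun f hf k := by
    intro k hk
    rw [h1 k hk]
    have := ht ▸ Finset.mem_image_of_mem t hk
    simpa [posSupp] using this
  have hmem : ∀ k, 0 < hashFun f hf k → k ∈ Finset.Ico (0 : ℤ) hf.toFinset.card := by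
    intro k hk
    by_contra hc
    exact hk.ne' (h2 k hc)
  refine IsTotallyLogConcave.of_isLogConcaveInt ?_ h ?_
  · intro k
    by_cases hk : k ∈ Finset.Ico (0 : ℤ) hf.toFinset.card
    · exact (hpos k hk).le
    · exact (h2 k hk).ge
  · intro x y z hxy hyz hx hz
    refine hpos y ?_
    have hx := hmem x hx
    have hz := hmem z hz
    rw [Finset.mem_Ico] at *
    omega

theorem posSupp_finite_of_conv {g g₁ h : ℤ → ℝ} {J : Finset ℤ} (hg₁0 : ∀ x, 0 ≤ g₁ x)
    (hg₁ : (posSupp g₁).Finite) (hh : ∀ a, h a = ∑ j ∈ J, g j * g₁ (a - j)) :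
    (posSupp h).Finite := by
  refine (J.finite_toSet.image2 (· + ·) hg₁).subset fun a (ha : 0 < h a) => ?_
  rw [hh] at ha
  obtain ⟨j, hj, hne⟩ := Finset.exists_ne_zero_of_sum_ne_zero ha.ne'
  exact ⟨j, hj, a - j, lt_of_le_of_ne (hg₁0 _) (right_ne_zero_of_mul hne).symm, by ring⟩

theorem massFun_zero {Ω : Type*} [MeasurableSpace Ω] (P : Measure Ω) [IsProbabilityMeasure P]
    (k : ℤ) : massFun P (fun _ => 0) k = if k = 0 then 1 else 0 := by
  unfold massFun
  split_ifs with h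
  · subst h; simp
  · rw [Set.preimage_const_of_notMem (by simpa using Ne.symm h), measureReal_empty]

/-! ### Induction on the summands -/

/-- Log-concavity of the squeezed sum is carried through the induction because the coupling at the
next summand requires it. The empty sum uses the identity map. -/
theorem isMonoMixture_massFun_sum {Ω Ω' ι : Type*} [MeasurableSpace Ω] [MeasurableSpace Ω']
    (P : Measure Ω) [IsProbabilityMeasure P] (Q : Measure Ω') [IsProbabilityMeasure Q]
    (X : ι → Ω → ℤ) (Y : ι → Ω' → ℤ) (hX : ∀ i, Measurable (X i)) (hXi : iIndepFun X P)
    (hfin : ∀ i, (posSupp (massFun P (X i))).Finite)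
    (hlc : ∀ i, IsHashLogConcave (massFun P (X i)) (hfin i))
    (hY : ∀ i, Measurable (Y i)) (hYi : iIndepFun Y Q)
    (hmass : ∀ i, massFun Q (Y i) = hashFun (massFun P (X i)) (hfin i)) (s : Finset ι) :
    (posSupp (massFun P fun ω => ∑ i ∈ s, X i ω)).Finite ∧
      IsTotallyLogConcave (massFun Q fun ω => ∑ i ∈ s, Y i ω) ∧
      ∃ S : Finset ℤ, (∀ x, x ∈ S ↔ 0 < massFun Q (fun ω => ∑ i ∈ s, Y i ω) x) ∧
        IsMonoMixture S (massFun Q fun ω => ∑ i ∈ s, Y i ω)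
          (massFun P fun ω => ∑ i ∈ s, X i ω) := by
  classical
  induction s using Finset.induction_on with
  | empty =>
    simp only [Finset.sum_empty]
    have hiff : ∀ x : ℤ, x ∈ ({0} : Finset ℤ) ↔ 0 < massFun Q (fun _ => 0) x := by
      intro x
      rw [massFun_zero, Finset.mem_singleton]
      split_ifs with h <;> simp [h]
    refine ⟨(Set.finite_singleton (0 : ℤ)).subset fun x (hx : 0 < massFun P _ x) => ?_, ?_,
      {0}, hiff, Unit, inferInstance, Measure.dirac (), inferInstance, fun _ r => r,
      fun r => measurable_const, fun _ => strictMonoOn_id, ?_⟩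
    · rw [massFun_zero] at hx
      by_contra h
      have h : x ≠ 0 := h
      rw [if_neg h] at hx
      exact hx.false
    · intro a b c d hab hbd heq
      simp only [massFun_zero]
      by_cases h : a = 0 ∧ d = 0
      · rw [if_pos h.1, if_pos h.2, if_pos (by omega), if_pos (by omega)]
      · have : ((if a = 0 then 1 else 0 : ℝ) * if d = 0 then 1 else 0) = 0 := by
          by_cases ha : a = 0
          · rw [if_neg (fun hd => h ⟨ha, hd⟩), mul_zero]
          · rw [if_neg ha, zero_mul]
        rw [this]
        positivity
    · intro a
      rw [Finset.sum_singleton, massFun_zero, massFun_zero, if_pos rfl, one_mul]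
      by_cases h : a = 0
      · simp [h]
      · simp [h, Ne.symm h]
  | insert i s his ih =>
    obtain ⟨hPfin, hLC, S, hS, hmix⟩ := ih
    obtain ⟨t, htmono, himage, hin, hout⟩ := exists_hashFun_reindex _ (hfin i)
    set J := Finset.Ico (0 : ℤ) (hfin i).toFinset.card with hJdef
    simp only [Finset.sum_insert his]
    have hXs : Measurable fun ω => ∑ j ∈ s, X j ω := Finset.measurable_sum s fun j _ => hX j
    have hYs : Measurable fun ω => ∑ j ∈ s, Y j ω := Finset.measurable_sum s fun j _ => hY j
    have indX : IndepFun (X i) (fun ω => ∑ j ∈ s, X j ω) P := by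
      have := (hXi.indepFun_finsetSum_of_notMem hX his).symm
      simpa only [Finset.sum_fn] using this
    have indY : IndepFun (Y i) (fun ω => ∑ j ∈ s, Y j ω) Q := by
      have := (hYi.indepFun_finsetSum_of_notMem hY his).symm
      simpa only [Finset.sum_fn] using this
    have hJ : ∀ k, k ∈ J ↔ 0 < massFun Q (Y i) k := by
      intro k
      rw [hmass]
      constructor
      · intro hk
        rw [hin k hk]
        have := himage ▸ Finset.mem_image_of_mem t hk
        simpa [posSupp] using this
      · intro hk
        by_contra hc
        exact hk.ne' (hout k hc)
    have convQ := massFun_add Q (hY i) hYs indY J hJ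
    have convP := massFun_add P (hX i) hXs indX (hfin i).toFinset
      (fun k => by simp [posSupp])
    have hLCi : IsTotallyLogConcave (massFun Q (Y i)) := by
      rw [hmass]
      exact (hlc i).isTotallyLogConcave
    have hQsfin : (posSupp (massFun Q fun ω => ∑ j ∈ s, Y j ω)).Finite :=
      S.finite_toSet.subset fun x hx => (hS x).2 hx
    have hQfin := posSupp_finite_of_conv (massFun_nonneg Q _) hQsfin convQ
    refine ⟨posSupp_finite_of_conv (massFun_nonneg P _) hPfin convP, ?_, hQfin.toFinset,
      fun x => by simp [posSupp], ?_⟩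
    · rw [funext convQ]
      exact hLC.conv hLCi J fun x hx =>
        le_antisymm (not_lt.1 (mt (hJ x).2 hx)) (massFun_nonneg _ _ _)
    · refine IsMonoMixture.conv (massFun_nonneg Q _) (massFun_nonneg Q _) hS hJ
        (fun x => by simp [posSupp]) hLC hLCi convQ hmix t htmono ?_
      intro a
      rw [convP, ← himage, Finset.sum_image htmono.injOn]
      refine Finset.sum_congr rfl fun j hj => ?_
      rw [hmass, hin j hj]

theorem mainTheorem3 {Ω Ω' : Type*} [MeasurableSpace Ω] [MeasurableSpace Ω']
    (P : Measure Ω) [IsProbabilityMeasure P] (Q : Measure Ω') [IsProbabilityMeasure Q]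
    (N : ℕ) (X : Fin N → Ω → ℤ) (Xhash : Fin N → Ω' → ℤ)
    (hXmeas : ∀ i, Measurable (X i))
    (hXindep : iIndepFun X P)
    (hXfin : ∀ i, (posSupp (massFun P (X i))).Finite)
    (hXlc : ∀ i, IsHashLogConcave (massFun P (X i)) (hXfin i))
    (hYmeas : ∀ i, Measurable (Xhash i))
    (hYindep : iIndepFun Xhash Q)
    (hYmass : ∀ i, massFun Q (Xhash i) = hashFun (massFun P (X i)) (hXfin i))
    (α : ℝ≥0∞) :
    renyiEntropy α Q (fun ω => ∑ i, Xhash i ω) ≤ renyiEntropy α P (fun ω => ∑ i, X i ω) := by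
  obtain ⟨hPfin, -, S, hS, hmix⟩ := isMonoMixture_massFun_sum P Q X Xhash hXmeas hXindep hXfin hXlc
    hYmeas hYindep hYmass Finset.univ
  have hne : S.Nonempty := by
    obtain ⟨ω, hω⟩ := (ae_mem_posSupp Q fun ω => ∑ i, Xhash i ω).exists
    exact ⟨_, (hS _).2 hω⟩
  exact hmix.renyiEntropyOfMass_le (massFun_nonneg Q _) (massFun_nonneg P _) hS
    (G := hPfin.toFinset) (fun a => by simp [posSupp]) hne α
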